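/- For $n\ge 0$ let $[n]=\{1,\dots,n\}$ and let $\mathsf{Cycle}_n$ be the simple graph on $[n]$ in which two distinct vertices are adjacent if and only if they differ by $\pm 1$ modulo $n$. For simple graphs $X$ and $Y$ on $[n]$, the friends-and-strangers graph $\mathsf{FS}(X,Y)$ is the graph whose vertices are the bijections $V(X)\to V(Y)$, where two bijections $\sigma,\tau$ are adjacent if and only if there is an edge $\{a,b\}$ of $X$ such that $\{\sigma(a),\sigma(b)\}$ is an edge of $Y$, $\sigma(a)=\tau(b)$, $\sigma(b)=\tau(a)$, and $\sigma(c)=\tau(c)$ for all vertices $c\ne a,b$ of $X$. The diameter of a connected component is the maximum, over pairs of its vertices, of the length of a shortest path between them. **Theorem.** There is a function $f:\mathbb{N}\to\mathbb{R}$ with $f(n)\to 0$ as $n\to\infty$ such that, for every $n\ge 0$ and every simple graph $Y$ on $[n]$, every connected component of $\mathsf{FS}(\mathsf{Cycle}_n,Y)$ has diameter at most $8n^4\,(1+f(n))$. -/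

import Mathlib

/-- The friends-and-strangers graph of `X` and `Y`: its vertices are the bijections from `V(X)` to
`V(Y)`, and `σ`, `τ` are adjacent if and only if there is an edge `{a, b}` of `X` whose image
`{σ a, σ b}` is an edge of `Y` such that `τ` is `σ` with the values at `a` and `b` exchanged. -/
def friendsAndStrangers {V W : Type*} (X : SimpleGraph V) (Y : SimpleGraph W) :
    SimpleGraph (V ≃ W) where
  Adj σ τ := ∃ a b : V, X.Adj a b ∧ Y.Adj (σ a) (σ b) ∧ σ a = τ b ∧ σ b = τ a ∧
    ∀ c : V, c ≠ a → c ≠ b → σ c = τ c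
  symm := ⟨by
    rintro σ τ ⟨a, b, hX, hY, hab, hba, hc⟩
    refine ⟨a, b, hX, ?_, hba.symm, hab.symm, fun c h1 h2 => (hc c h1 h2).symm⟩
    rw [← hab, ← hba]
    exact hY.symm⟩
  loopless := ⟨by
    rintro σ ⟨a, b, hX, -, hab, -⟩
    exact hX.ne (σ.injective hab)⟩

/-- On finitely many vertices a connected component of a friends-and-strangers graph has finite
extended diameter, so its natural-number diameter is the maximum of the distances. -/
theorem friendsAndStrangers_component_ediam_ne_top {n : ℕ} (X Y : SimpleGraph (Fin n))
    (C : (friendsAndStrangers X Y).ConnectedComponent) : C.toSimpleGraph.ediam ≠ ⊤ := by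
  have : Finite C := Subtype.finite
  have : Nonempty C := C.nonempty_supp.to_subtype
  exact SimpleGraph.connected_iff_ediam_ne_top.mp C.connected_toSimpleGraph

/-! Write `N` for the number of people and lift their positions on the cycle to integers `x r`, so
that an exchange moves one person forward and the other back and preserves `∑ r, x r`. The floor of
`(x r - x s) / N` records how often `r` has overtaken `s`; it changes only when these two are
exchanged. Along any walk the sum and the floors of strangers are therefore invariant
(`exists_isLift_of_walk`). Conversely, these invariants suffice: if two lifts share them, bubble
sort joins the arrangements, and its length is at most the total difference of floors
(`exists_walk_length_le`). A given walk may end in a lift that winds far around. Its winding numbers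
differ by at most one between strangers, so constants on the components of `Yᶜ` bring them down to
order `N ^ 2` without altering the invariants (`exists_abs_le_of_sum_eq_zero`). Summing over `N ^ 2`
ordered pairs gives `8 * N ^ 4`. -/

/-- Adding one to an integer does not change its quotient by `N`, unless it reaches a multiple. -/
theorem Int.add_one_ediv_of_not_dvd {N d : ℤ} (hN : 0 < N) (h : ¬ N ∣ d + 1) :
    (d + 1) / N = d / N := by
  have h1 := Int.mul_ediv_add_emod d N
  have h2 := Int.emod_nonneg d hN.ne'
  have h3 := Int.emod_lt_of_pos d hN
  have h4 : d % N + 1 ≠ N := fun h4 => h ⟨d / N + 1, by linarith⟩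
  rw [Int.ediv_eq_iff_of_pos hN]
  constructor <;> nlinarith [lt_of_le_of_ne (Int.add_one_le_of_lt h3) h4]

/-! ### Integer lifts and their invariants -/

namespace FriendsAndStrangers

variable {n : ℕ}

/-- A lift of the arrangement `σ` of people around the cycle: each person gets an integer position
which reduces modulo the length of the cycle to the actual position. -/
def IsLift (σ : Fin (n + 2) ≃ Fin (n + 2)) (x : Fin (n + 2) → ℤ) : Prop :=
  ∀ i, x (σ i) ≡ (i : ℕ) [ZMOD (n + 2 : ℕ)]

/-- Move person `p` one step forward and person `q` one step back. -/
def exchange (p q : Fin (n + 2)) (x : Fin (n + 2) → ℤ) (r : Fin (n + 2)) : ℤ :=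
  x r + (if r = p then 1 else 0) - (if r = q then 1 else 0)

theorem sum_exchange (p q : Fin (n + 2)) (x : Fin (n + 2) → ℤ) :
    ∑ r, exchange p q x r = ∑ r, x r := by
  simp [exchange, Finset.sum_sub_distrib, Finset.sum_add_distrib]

theorem fin_val_add_one_modEq (i : Fin (n + 2)) :
    (((i + 1 : Fin (n + 2)) : ℕ) : ℤ) ≡ (i : ℕ) + 1 [ZMOD (n + 2 : ℕ)] := by
  have h : ((i + 1 : Fin (n + 2)) : ℕ) ≡ (i : ℕ) + 1 [MOD (n + 2)] := by
    rw [Fin.val_add]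
    simpa using Nat.mod_modEq _ _
  exact_mod_cast Int.natCast_modEq_iff.mpr h

namespace IsLift

variable {σ : Fin (n + 2) ≃ Fin (n + 2)} {x : Fin (n + 2) → ℤ}

theorem eq_of_modEq (hx : IsLift σ x) {r s : Fin (n + 2)}
    (h : x r ≡ x s [ZMOD (n + 2 : ℕ)]) : r = s := by
  obtain ⟨i, rfl⟩ := σ.surjective r
  obtain ⟨j, rfl⟩ := σ.surjective s
  have h1 := ((hx i).symm.trans h).trans (hx j)
  rw [Int.natCast_modEq_iff] at h1
  rw [Fin.ext (h1.eq_of_lt_of_lt i.2 j.2)]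

theorem not_dvd_sub (hx : IsLift σ x) {r s : Fin (n + 2)} (h : r ≠ s) :
    ¬ ((n + 2 : ℕ) : ℤ) ∣ x r - x s := fun hd =>
  h (hx.eq_of_modEq (Int.modEq_iff_dvd.mpr hd).symm)

theorem ext_of_isLift {τ : Fin (n + 2) ≃ Fin (n + 2)} (hx : IsLift σ x) (hy : IsLift τ x) :
    σ = τ := by
  ext i : 1
  apply hx.eq_of_modEq
  exact (hx i).trans (hy i).symm

theorem dvd_succ (hx : IsLift σ x) (i : Fin (n + 2)) :
    ((n + 2 : ℕ) : ℤ) ∣ x (σ i) - x (σ (i + 1)) + 1 := by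
  have h := ((hx (i + 1)).trans (fin_val_add_one_modEq i)).trans ((hx i).add_right 1).symm
  have := h.dvd
  convert this using 1
  ring

theorem exchange_swap (hx : IsLift σ x) (i : Fin (n + 2)) :
    IsLift ((Equiv.swap i (i + 1)).trans σ) (exchange (σ i) (σ (i + 1)) x) := by
  intro j
  have hi : i ≠ i + 1 := by simp
  have h1 := hx i
  have h2 := hx (i + 1)
  have h3 := fin_val_add_one_modEq i
  rcases eq_or_ne j i with rfl | hj
  · simp only [exchange, Equiv.trans_apply, Equiv.swap_apply_left, σ.injective.eq_iff, hi.symm,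
      if_true, if_false]
    have := (h2.trans h3).sub_right 1
    simpa using this
  rcases eq_or_ne j (i + 1) with rfl | hj'
  · simp only [exchange, Equiv.trans_apply, Equiv.swap_apply_right, σ.injective.eq_iff, hi,
      if_true, if_false]
    have := (h1.add_right 1).trans h3.symm
    simpa using this
  · simp only [exchange, Equiv.trans_apply, Equiv.swap_apply_of_ne_of_ne hj hj',
      σ.injective.eq_iff, hj, hj', if_false]
    simpa using hx j

/-- A difference that moves by one changes its floor only on reaching or leaving a multiple of `N`
from below. Distinct people occupy distinct residues, so only the exchanged pair can do this. -/
theorem exchange_ediv (hx : IsLift σ x) (i : Fin (n + 2)) {r s : Fin (n + 2)}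
    (h1 : ¬ (r = σ i ∧ s = σ (i + 1))) (h2 : ¬ (r = σ (i + 1) ∧ s = σ i)) :
    (exchange (σ i) (σ (i + 1)) x r - exchange (σ i) (σ (i + 1)) x s) / ((n + 2 : ℕ) : ℤ) =
      (x r - x s) / ((n + 2 : ℕ) : ℤ) := by
  have hN : (0 : ℤ) < ((n + 2 : ℕ) : ℤ) := by positivity
  have hpq : σ i ≠ σ (i + 1) := by simp [σ.injective.eq_iff]
  have hd := hx.dvd_succ i
  set p := σ i
  set q := σ (i + 1)
  rcases eq_or_ne r s with rfl | hrs
  · simp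
  have h0 := hx.not_dvd_sub hrs
  have key : ∀ d : ℤ, ¬ ((n + 2 : ℕ) : ℤ) ∣ d →
      (d - 1) / ((n + 2 : ℕ) : ℤ) = d / ((n + 2 : ℕ) : ℤ) := fun d h => by
    have := Int.add_one_ediv_of_not_dvd (d := d - 1) hN (by simpa using h)
    simpa using this.symm
  rcases eq_or_ne r p with rfl | hrp
  · have hsq : s ≠ q := fun h => h1 ⟨rfl, h⟩
    have h3 : ¬ ((n + 2 : ℕ) : ℤ) ∣ x p - x s + 1 := fun h =>
      hx.not_dvd_sub hsq.symm (by
        rw [show x q - x s = x p - x s + 1 - (x p - x q + 1) by ring]; exact dvd_sub h hd)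
    rw [← Int.add_one_ediv_of_not_dvd hN h3]
    simp only [exchange, hpq, hrs.symm, hsq, if_true, if_false]
    congr 1; ring
  rcases eq_or_ne r q with rfl | hrq
  · have hsp : s ≠ p := fun h => h2 ⟨rfl, h⟩
    rw [← key _ h0]
    simp only [exchange, hpq.symm, hrs.symm, hsp, if_true, if_false]
    congr 1; ring
  rcases eq_or_ne s p with rfl | hsp
  · rw [← key _ h0]
    simp only [exchange, hpq, hrp, hrq, if_true, if_false]
    congr 1; ring
  rcases eq_or_ne s q with rfl | hsq
  · have h3 : ¬ ((n + 2 : ℕ) : ℤ) ∣ x r - x q + 1 := fun h =>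
      hx.not_dvd_sub hrp (by
        rw [show x r - x p = x r - x q + 1 - (x p - x q + 1) by ring]; exact dvd_sub h hd)
    rw [← Int.add_one_ediv_of_not_dvd hN h3]
    simp only [exchange, hpq.symm, hrp, hrq, if_true, if_false]
    congr 1; ring
  · simp [exchange, hrp, hrq, hsp, hsq]

end IsLift

theorem adj_swap {Y : SimpleGraph (Fin (n + 2))} (σ : Fin (n + 2) ≃ Fin (n + 2))
    (i : Fin (n + 2)) (h : Y.Adj (σ i) (σ (i + 1))) :
    (friendsAndStrangers (SimpleGraph.cycleGraph (n + 2)) Y).Adj σ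
      ((Equiv.swap i (i + 1)).trans σ) := by
  refine ⟨i, i + 1, ?_, h, by simp, by simp, fun c h1 h2 => ?_⟩
  · simp [SimpleGraph.cycleGraph_adj]
  · simp [Equiv.swap_apply_of_ne_of_ne h1 h2]

theorem exists_swap_of_adj {Y : SimpleGraph (Fin (n + 2))} {σ τ : Fin (n + 2) ≃ Fin (n + 2)}
    (h : (friendsAndStrangers (SimpleGraph.cycleGraph (n + 2)) Y).Adj σ τ) :
    ∃ i, Y.Adj (σ i) (σ (i + 1)) ∧ τ = (Equiv.swap i (i + 1)).trans σ := by
  obtain ⟨a, b, hX, hY, hab, hba, hc⟩ := h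
  have hτ : τ = (Equiv.swap a b).trans σ := by
    ext c : 1
    rcases eq_or_ne c a with rfl | h1
    · simp [hba]
    rcases eq_or_ne c b with rfl | h2
    · simp [hab]
    · simp [Equiv.swap_apply_of_ne_of_ne h1 h2, hc c h1 h2]
  rw [SimpleGraph.cycleGraph_adj] at hX
  rcases hX with h | h
  · obtain rfl : a = b + 1 := by rw [← h]; abel
    exact ⟨b, hY.symm, by rw [hτ, Equiv.swap_comm]⟩
  · obtain rfl : b = a + 1 := by rw [← h]; abel
    exact ⟨a, hY, hτ⟩

/-- Following a walk in the friends-and-strangers graph, a lift of its start is carried to a lift of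
its end with the same sum, and strangers never pass each other. -/
theorem exists_isLift_of_walk {Y : SimpleGraph (Fin (n + 2))} {σ τ : Fin (n + 2) ≃ Fin (n + 2)}
    (w : (friendsAndStrangers (SimpleGraph.cycleGraph (n + 2)) Y).Walk σ τ)
    (x : Fin (n + 2) → ℤ) (hx : IsLift σ x) :
    ∃ y, IsLift τ y ∧ ∑ r, y r = ∑ r, x r ∧ ∀ r s, ¬ Y.Adj r s →
      (y r - y s) / ((n + 2 : ℕ) : ℤ) = (x r - x s) / ((n + 2 : ℕ) : ℤ) := by
  induction w generalizing x with
  | nil => exact ⟨x, hx, rfl, fun _ _ _ => rfl⟩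
  | cons h _ ih =>
    obtain ⟨i, hY, rfl⟩ := exists_swap_of_adj h
    obtain ⟨y, hy, hsum, hstr⟩ := ih _ (hx.exchange_swap i)
    refine ⟨y, hy, hsum.trans (sum_exchange _ _ _), fun r s hrs => ?_⟩
    rw [hstr r s hrs]
    refine hx.exchange_ediv i ?_ ?_
    · rintro ⟨rfl, rfl⟩; exact hrs hY
    · rintro ⟨rfl, rfl⟩; exact hrs hY.symm

end FriendsAndStrangers

/-! ### Bubble sort on the cycle -/

namespace FriendsAndStrangers

variable {n : ℕ}

/-- The number of times that two lifted arrangements disagree on who is ahead of whom, counted over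
ordered pairs of people. -/
def disagreement (x y : Fin (n + 2) → ℤ) : ℕ :=
  ∑ r, ∑ s, ((x r - x s) / ((n + 2 : ℕ) : ℤ) - (y r - y s) / ((n + 2 : ℕ) : ℤ)).natAbs

/-- A function on the cycle that never decreases along a step is constant. -/
theorem eq_of_forall_le_add_one {d : Fin (n + 2) → ℤ} (h : ∀ i, d i ≤ d (i + 1)) (i : Fin (n + 2)) :
    d i = d 0 := by
  have hs : ∑ i, d i = ∑ i, d (i + 1) := (Equiv.sum_comp (Equiv.addRight 1) d).symm
  have he : ∀ i, d i = d (i + 1) := fun i =>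
    (Finset.sum_eq_sum_iff_of_le fun i _ => h i).mp hs i (Finset.mem_univ i)
  induction i using Fin.induction with
  | zero => rfl
  | succ i ih => rw [← ih, he i.castSucc, Fin.coeSucc_eq_succ]

/-- Two different lifts with the same sum are told apart by some pair of neighbours. -/
theorem exists_lt_of_sum_eq {σ : Fin (n + 2) ≃ Fin (n + 2)} {x y : Fin (n + 2) → ℤ}
    (hs : ∑ r, x r = ∑ r, y r) (hne : x ≠ y) :
    ∃ i, y (σ (i + 1)) - x (σ (i + 1)) < y (σ i) - x (σ i) := by
  by_contra! h
  have hc := eq_of_forall_le_add_one (d := fun i => y (σ i) - x (σ i)) h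
  have h1 : ∑ i, (y (σ i) - x (σ i)) = 0 := by
    rw [Equiv.sum_comp σ (fun r => y r - x r), Finset.sum_sub_distrib, hs, sub_self]
  rw [Finset.sum_congr rfl fun i _ => hc i] at h1
  rw [Finset.sum_const, Finset.card_univ, Fintype.card_fin, smul_eq_zero] at h1
  have h2 : y (σ 0) - x (σ 0) = 0 := h1.resolve_left (by omega)
  refine hne (funext fun r => ?_)
  have := hc (σ.symm r)
  simp only [Equiv.apply_symm_apply] at this
  linarith

section Neighbours

variable {σ τ : Fin (n + 2) ≃ Fin (n + 2)} {x y : Fin (n + 2) → ℤ} {i : Fin (n + 2)}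

/-- The floors attached to two neighbours, before and after they are exchanged, compared with the
floors in an arrangement where they are in the other order. -/
theorem IsLift.floors_of_lt (hx : IsLift σ x) (hy : IsLift τ y)
    (h : y (σ (i + 1)) - x (σ (i + 1)) < y (σ i) - x (σ i)) :
    ∃ k : ℤ, (x (σ i) - x (σ (i + 1))) / ((n + 2 : ℕ) : ℤ) = k - 1 ∧
      (x (σ i) - x (σ (i + 1)) + 2) / ((n + 2 : ℕ) : ℤ) = k ∧
      k ≤ (y (σ i) - y (σ (i + 1))) / ((n + 2 : ℕ) : ℤ) ∧
      (x (σ (i + 1)) - x (σ i)) / ((n + 2 : ℕ) : ℤ) = -k ∧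
      (x (σ (i + 1)) - x (σ i) - 2) / ((n + 2 : ℕ) : ℤ) = -k - 1 ∧
      (y (σ (i + 1)) - y (σ i)) / ((n + 2 : ℕ) : ℤ) ≤ -k - 1 := by
  obtain ⟨k, hk⟩ := hx.dvd_succ i
  have hpq : σ (i + 1) ≠ σ i := by simp [σ.injective.eq_iff]
  have hnd := hy.not_dvd_sub hpq
  have hN : (2 : ℤ) ≤ ((n + 2 : ℕ) : ℤ) := by push_cast; linarith [Int.natCast_nonneg n]
  have hN0 : (0 : ℤ) < ((n + 2 : ℕ) : ℤ) := by linarith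
  generalize ((n + 2 : ℕ) : ℤ) = N at *
  -- The hypothesis gives only `≤`; equality would put two people on one residue in `y`.
  have hlt : y (σ (i + 1)) - y (σ i) < N * -k := by
    refine lt_of_le_of_ne (by linarith) fun he => hnd ⟨-k, he⟩
  refine ⟨k, ?_, ?_, ?_, ?_, ?_, ?_⟩
  · rw [Int.ediv_eq_iff_of_pos hN0]; constructor <;> linarith
  · rw [Int.ediv_eq_iff_of_pos hN0]; constructor <;> linarith
  · rw [Int.le_ediv_iff_mul_le hN0]; linarith
  · rw [Int.ediv_eq_iff_of_pos hN0]; constructor <;> linarith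
  · rw [Int.ediv_eq_iff_of_pos hN0]; constructor <;> linarith
  · rw [Int.le_sub_one_iff, Int.ediv_lt_iff_lt_mul hN0]; linarith

/-- Only the floors of the exchanged pair change, one for each order, and each moves one unit
towards its value in `y`. -/
theorem disagreement_exchange_lt (hx : IsLift σ x) (hy : IsLift τ y)
    (h : y (σ (i + 1)) - x (σ (i + 1)) < y (σ i) - x (σ i)) :
    disagreement (exchange (σ i) (σ (i + 1)) x) y < disagreement x y := by
  obtain ⟨k, h1, h2, h3, h4, h5, h6⟩ := hx.floors_of_lt hy h
  have hpq : σ i ≠ σ (i + 1) := by simp [σ.injective.eq_iff]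
  have e1 : exchange (σ i) (σ (i + 1)) x (σ i) = x (σ i) + 1 := by simp [exchange]
  have e2 : exchange (σ i) (σ (i + 1)) x (σ (i + 1)) = x (σ (i + 1)) - 1 := by simp [exchange]
  have hpair : ((exchange (σ i) (σ (i + 1)) x (σ i) - exchange (σ i) (σ (i + 1)) x (σ (i + 1))) /
        ((n + 2 : ℕ) : ℤ) - (y (σ i) - y (σ (i + 1))) / ((n + 2 : ℕ) : ℤ)).natAbs <
      ((x (σ i) - x (σ (i + 1))) / ((n + 2 : ℕ) : ℤ) -
        (y (σ i) - y (σ (i + 1))) / ((n + 2 : ℕ) : ℤ)).natAbs := by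
    rw [e1, e2, show x (σ i) + 1 - (x (σ (i + 1)) - 1) = x (σ i) - x (σ (i + 1)) + 2 by ring, h1, h2]
    omega
  have hall : ∀ r s,
      ((exchange (σ i) (σ (i + 1)) x r - exchange (σ i) (σ (i + 1)) x s) / ((n + 2 : ℕ) : ℤ) -
        (y r - y s) / ((n + 2 : ℕ) : ℤ)).natAbs ≤
      ((x r - x s) / ((n + 2 : ℕ) : ℤ) - (y r - y s) / ((n + 2 : ℕ) : ℤ)).natAbs := by
    intro r s
    by_cases c1 : r = σ i ∧ s = σ (i + 1)
    · obtain ⟨rfl, rfl⟩ := c1; exact hpair.le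
    by_cases c2 : r = σ (i + 1) ∧ s = σ i
    · obtain ⟨rfl, rfl⟩ := c2
      rw [e1, e2, show x (σ (i + 1)) - 1 - (x (σ i) + 1) = x (σ (i + 1)) - x (σ i) - 2 by ring,
        h4, h5]
      omega
    · rw [hx.exchange_ediv i c1 c2]
  exact Finset.sum_lt_sum (fun r _ => Finset.sum_le_sum fun s _ => hall r s)
    ⟨σ i, Finset.mem_univ _, Finset.sum_lt_sum (fun s _ => hall _ s)
      ⟨σ (i + 1), Finset.mem_univ _, hpair⟩⟩

end Neighbours

/-- Bubble sort on the cycle: if strangers are in the same order in two lifted arrangements with the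
same sum, then each step of the sort exchanges friends. -/
theorem exists_walk_length_le {Y : SimpleGraph (Fin (n + 2))} {σ τ : Fin (n + 2) ≃ Fin (n + 2)}
    {x y : Fin (n + 2) → ℤ} (hx : IsLift σ x) (hy : IsLift τ y) (hsum : ∑ r, x r = ∑ r, y r)
    (hstr : ∀ r s, ¬ Y.Adj r s →
      (x r - x s) / ((n + 2 : ℕ) : ℤ) = (y r - y s) / ((n + 2 : ℕ) : ℤ)) :
    ∃ w : (friendsAndStrangers (SimpleGraph.cycleGraph (n + 2)) Y).Walk σ τ,
      w.length ≤ disagreement x y := by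
  induction hm : disagreement x y using Nat.strong_induction_on generalizing σ x with
  | _ m ih =>
    by_cases hxy : x = y
    · subst hxy
      obtain rfl := hx.ext_of_isLift hy
      exact ⟨.nil, by simp⟩
    obtain ⟨i, hi⟩ := exists_lt_of_sum_eq (σ := σ) hsum hxy
    -- For strangers the floors agree, but here one is `k - 1` and the other at least `k`.
    have hY : Y.Adj (σ i) (σ (i + 1)) := by
      by_contra hY
      obtain ⟨k, h1, -, h3, -⟩ := hx.floors_of_lt hy hi
      have := hstr _ _ hY
      omega
    have hlt := disagreement_exchange_lt hx hy hi
    obtain ⟨w, hw⟩ := ih _ (hm ▸ hlt) (hx.exchange_swap i) ((sum_exchange _ _ _).trans hsum)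
      (fun r s hrs => by
        rw [← hstr r s hrs]
        refine hx.exchange_ediv i ?_ ?_
        · rintro ⟨rfl, rfl⟩; exact hrs hY
        · rintro ⟨rfl, rfl⟩; exact hrs hY.symm) rfl
    exact ⟨.cons (adj_swap σ i hY) w, by rw [SimpleGraph.Walk.length_cons]; omega⟩

end FriendsAndStrangers

/-! ### Shrinking an integer potential on a graph -/

namespace SimpleGraph

variable {V : Type*} {G : SimpleGraph V} {c : V → ℤ}

theorem Walk.abs_sub_le_length (h : ∀ u v, G.Adj u v → |c u - c v| ≤ 1) {u v : V}
    (w : G.Walk u v) : |c u - c v| ≤ w.length := by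
  induction w with
  | nil => simp
  | cons huv _ ih =>
    have := abs_sub_le _ _ _ |>.trans (add_le_add (h _ _ huv) ih)
    rw [Walk.length_cons]
    push_cast
    linarith

theorem Reachable.abs_sub_le_card [Fintype V] (h : ∀ u v, G.Adj u v → |c u - c v| ≤ 1) {u v : V}
    (huv : G.Reachable u v) : |c u - c v| ≤ Fintype.card V := by
  obtain ⟨w, hw⟩ := huv.exists_isPath
  exact (w.abs_sub_le_length h).trans (by exact_mod_cast hw.length_lt.le)

/-- An integer function of sum zero that changes by at most one along edges can be made small by
adding constants on the connected components, without changing the sum. -/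
theorem exists_abs_le_of_sum_eq_zero [Fintype V] (h : ∀ u v, G.Adj u v → |c u - c v| ≤ 1)
    (hsum : ∑ v, c v = 0) :
    ∃ d : V → ℤ, ∑ v, d v = 0 ∧ (∀ u v, G.Adj u v → d u - d v = c u - c v) ∧
      ∀ v, |d v| ≤ 2 * (Fintype.card V : ℤ) ^ 2 + Fintype.card V := by
  classical
  rcases isEmpty_or_nonempty V with hV | ⟨⟨v₀⟩⟩
  · exact ⟨c, hsum, fun _ _ _ => rfl, fun v => hV.elim v⟩
  let root : V → V := fun v => (G.connectedComponentMk v).out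
  have hroot : ∀ v, G.Reachable v (root v) := fun v =>
    (ConnectedComponent.exact (Quot.out_eq (G.connectedComponentMk v))).symm
  have hadj : ∀ u v, G.Adj u v → root u = root v := fun u v huv => by
    simp only [root, ConnectedComponent.sound huv.reachable]
  -- The component `S` balances the sum: elsewhere the shifts are multiples of `m = S.card`, so one
  -- integer `K` added throughout `S` compensates them.
  let S : Finset V := Finset.univ.filter fun v => root v = root v₀
  have hS : ∀ v, v ∈ S ↔ root v = root v₀ := fun v => by simp [S]
  set m : ℤ := (S.card : ℤ) with hm
  set N : ℤ := (Fintype.card V : ℤ) with hN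
  have hm0 : 0 < m := by
    have : 0 < S.card := Finset.card_pos.mpr ⟨v₀, (hS _).mpr rfl⟩
    rw [hm]; exact_mod_cast this
  have hmN : m ≤ N := by rw [hm, hN]; exact_mod_cast S.card_le_univ
  set K : ℤ := ∑ v ∈ Sᶜ, c (root v) / m with hK
  let d : V → ℤ := fun v => if v ∈ S then c v + K else c v - m * (c (root v) / m)
  have hdS : ∀ v ∈ S, d v = c v + K := fun v hv => if_pos hv
  have hdS' : ∀ v ∈ Sᶜ, d v = c v - m * (c (root v) / m) := fun v hv =>
    if_neg (Finset.mem_compl.mp hv)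
  have hsum' : ∑ v, d v = 0 := by
    rw [← Finset.sum_add_sum_compl S, Finset.sum_congr rfl hdS, Finset.sum_congr rfl hdS',
      Finset.sum_add_distrib, Finset.sum_sub_distrib, ← Finset.mul_sum, ← hK, Finset.sum_const,
      nsmul_eq_mul, ← hm]
    rw [← Finset.sum_add_sum_compl S] at hsum
    linarith
  have hoff : ∀ v ∈ Sᶜ, |d v| ≤ 2 * N := fun v hv => by
    have h1 := (hroot v).abs_sub_le_card h
    have h2 := Int.mul_ediv_add_emod (c (root v)) m
    have h3 := Int.emod_nonneg (c (root v)) hm0.ne'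
    have h4 := Int.emod_lt_of_pos (c (root v)) hm0
    rw [hdS' v hv]
    rw [abs_le] at h1 ⊢
    constructor <;> linarith [h1.1, h1.2]
  refine ⟨d, hsum', fun u v huv => ?_, fun v => ?_⟩
  · have hr := hadj u v huv
    have hiff : u ∈ S ↔ v ∈ S := by rw [hS, hS, hr]
    by_cases hu : u ∈ S
    · rw [hdS u hu, hdS v (hiff.mp hu)]; ring
    · rw [hdS' u (Finset.mem_compl.mpr hu), hdS' v (Finset.mem_compl.mpr (mt hiff.mpr hu)), hr]
      ring
  by_cases hv : v ∈ S
  swap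
  · refine (hoff v (Finset.mem_compl.mpr hv)).trans ?_
    nlinarith
  have h1 : |∑ u ∈ Sᶜ, d u| ≤ N * (2 * N) := by
    refine (Finset.abs_sum_le_sum_abs _ _).trans ((Finset.sum_le_sum hoff).trans ?_)
    rw [Finset.sum_const, nsmul_eq_mul]
    have : ((Sᶜ.card : ℕ) : ℤ) ≤ N := by rw [hN]; exact_mod_cast Sᶜ.card_le_univ
    exact mul_le_mul_of_nonneg_right this (by linarith)
  have h2 : |∑ u ∈ S, (d v - d u)| ≤ m * N := by
    refine (Finset.abs_sum_le_sum_abs _ _).trans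
      ((Finset.sum_le_card_nsmul S _ N fun u hu => ?_).trans ?_)
    · rw [hdS v hv, hdS u hu, add_sub_add_right_eq_sub]
      refine Reachable.abs_sub_le_card h ?_
      exact (hroot v).trans (((hS v).mp hv).trans ((hS u).mp hu).symm ▸ (hroot u).symm)
    · rw [nsmul_eq_mul]
  -- As the total is zero, the sum over `S` is minus the sum outside, which is already bounded.
  have h3 : m * d v = ∑ u ∈ S, (d v - d u) - ∑ u ∈ Sᶜ, d u := by
    rw [← Finset.sum_add_sum_compl S] at hsum'
    rw [Finset.sum_sub_distrib, Finset.sum_const, nsmul_eq_mul]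
    linarith
  have h4 : m * |d v| ≤ m * N + N * (2 * N) := by
    rw [← abs_of_pos hm0, ← abs_mul, h3, abs_of_pos hm0]
    exact (abs_sub _ _).trans (add_le_add h2 h1)
  by_contra! hlt
  nlinarith

end SimpleGraph

/-! ### The quartic bound -/

namespace FriendsAndStrangers

variable {n : ℕ}

/-- The lift that places everybody at the representative of their position in `[0, n + 2)`. -/
def stdLift (σ : Fin (n + 2) ≃ Fin (n + 2)) (r : Fin (n + 2)) : ℤ := ((σ.symm r : ℕ) : ℤ)

theorem isLift_stdLift (σ : Fin (n + 2) ≃ Fin (n + 2)) : IsLift σ (stdLift σ) := fun i => by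
  simp [stdLift, Int.ModEq.refl]

theorem sum_stdLift (σ τ : Fin (n + 2) ≃ Fin (n + 2)) :
    ∑ r, stdLift σ r = ∑ r, stdLift τ r := by
  simp only [stdLift]
  rw [Equiv.sum_comp σ.symm (fun i : Fin (n + 2) => ((i : ℕ) : ℤ)),
    Equiv.sum_comp τ.symm (fun i : Fin (n + 2) => ((i : ℕ) : ℤ))]

theorem stdLift_sub_ediv (σ : Fin (n + 2) ≃ Fin (n + 2)) (r s : Fin (n + 2)) :
    -1 ≤ (stdLift σ r - stdLift σ s) / ((n + 2 : ℕ) : ℤ) ∧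
      (stdLift σ r - stdLift σ s) / ((n + 2 : ℕ) : ℤ) ≤ 0 := by
  have hN : (0 : ℤ) < ((n + 2 : ℕ) : ℤ) := by positivity
  have h1 := (σ.symm r).2
  have h2 := (σ.symm s).2
  constructor
  · rw [Int.le_ediv_iff_mul_le hN]; simp only [stdLift]; omega
  · rw [← Int.lt_add_one_iff, Int.ediv_lt_iff_lt_mul hN]; simp only [stdLift]; omega

theorem exists_walk_length_le_of_reachable {Y : SimpleGraph (Fin (n + 2))}
    {σ τ : Fin (n + 2) ≃ Fin (n + 2)}
    (h : (friendsAndStrangers (SimpleGraph.cycleGraph (n + 2)) Y).Reachable σ τ) :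
    ∃ w : (friendsAndStrangers (SimpleGraph.cycleGraph (n + 2)) Y).Walk σ τ,
      w.length ≤ 8 * (n + 2) ^ 4 := by
  obtain ⟨w⟩ := h
  obtain ⟨z, hz, hzsum, hzstr⟩ := exists_isLift_of_walk w _ (isLift_stdLift σ)
  have hN : (0 : ℤ) < ((n + 2 : ℕ) : ℤ) := by positivity
  have hdvd : ∀ r, ((n + 2 : ℕ) : ℤ) ∣ z r - stdLift τ r := fun r => by
    obtain ⟨i, rfl⟩ := τ.surjective r
    exact ((isLift_stdLift τ i).trans (hz i).symm).dvd
  choose c hc using hdvd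
  have hdiff : ∀ (e : Fin (n + 2) → ℤ) r s,
      (stdLift τ r + ((n + 2 : ℕ) : ℤ) * e r - (stdLift τ s + ((n + 2 : ℕ) : ℤ) * e s)) /
        ((n + 2 : ℕ) : ℤ) = (stdLift τ r - stdLift τ s) / ((n + 2 : ℕ) : ℤ) + (e r - e s) :=
    fun e r s => by
      rw [← Int.add_mul_ediv_left _ _ hN.ne']
      congr 1; ring
  have hz' : ∀ r, z r = stdLift τ r + ((n + 2 : ℕ) : ℤ) * c r := fun r => by rw [← hc]; ring
  have hcsum : ∑ r, c r = 0 := by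
    have h1 : ((n + 2 : ℕ) : ℤ) * ∑ r, c r = 0 := by
      rw [Finset.mul_sum, ← Finset.sum_congr rfl fun r _ => hc r, Finset.sum_sub_distrib, hzsum,
        sum_stdLift σ τ, sub_self]
    exact (mul_eq_zero.mp h1).resolve_left hN.ne'
  -- Standard floors are `-1` or `0`, and strangers keep theirs along the walk, so `c r - c s` is a
  -- difference of two such values.
  have hcadj : ∀ r s, Yᶜ.Adj r s → |c r - c s| ≤ 1 := fun r s hrs => by
    have h1 := hzstr r s ((SimpleGraph.compl_adj _ _ _).mp hrs).2
    rw [hz', hz', hdiff] at h1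
    have h2 := stdLift_sub_ediv σ r s
    have h3 := stdLift_sub_ediv τ r s
    rw [abs_le]
    constructor <;> linarith [h2.1, h2.2, h3.1, h3.2]
  obtain ⟨e, hesum, headj, hebd⟩ := SimpleGraph.exists_abs_le_of_sum_eq_zero hcadj hcsum
  rw [Fintype.card_fin] at hebd
  obtain ⟨v, hv⟩ := exists_walk_length_le (Y := Y) (isLift_stdLift σ)
    (y := fun r => stdLift τ r + ((n + 2 : ℕ) : ℤ) * e r) (τ := τ)
    (fun i => Int.ModEq.trans (Int.modEq_iff_dvd.mpr ⟨-e (τ i), by ring⟩) (isLift_stdLift τ i))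
    (by rw [Finset.sum_add_distrib, ← Finset.mul_sum, hesum, mul_zero, add_zero, sum_stdLift σ τ])
    (fun r s hrs => by
      rcases eq_or_ne r s with rfl | hne
      · simp
      rw [hdiff, headj r s ((SimpleGraph.compl_adj _ _ _).mpr ⟨hne, hrs⟩), ← hdiff, ← hz', ← hz',
        hzstr r s hrs])
  refine ⟨v, hv.trans ?_⟩
  -- The actual bound is `2 * (2 * N ^ 2 + N) + 1`, with `N = n + 2`.
  have hpair : ∀ r s, ((stdLift σ r - stdLift σ s) / ((n + 2 : ℕ) : ℤ) -
      (stdLift τ r + ((n + 2 : ℕ) : ℤ) * e r - (stdLift τ s + ((n + 2 : ℕ) : ℤ) * e s)) /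
        ((n + 2 : ℕ) : ℤ)).natAbs ≤ 8 * (n + 2) ^ 2 := fun r s => by
    rw [hdiff]
    have h2 := stdLift_sub_ediv σ r s
    have h3 := stdLift_sub_ediv τ r s
    have h4 := abs_le.mp (hebd r)
    have h5 := abs_le.mp (hebd s)
    zify
    push_cast at *
    rw [abs_le]
    constructor <;> nlinarith [h2.1, h2.2, h3.1, h3.2, h4.1, h4.2, h5.1, h5.2]
  refine (Finset.sum_le_sum fun r _ => Finset.sum_le_sum fun s _ => hpair r s).trans ?_
  simp only [Finset.sum_const, Finset.card_univ, Fintype.card_fin, smul_eq_mul]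
  exact le_of_eq (by ring)

end FriendsAndStrangers

theorem SimpleGraph.ConnectedComponent.diam_toSimpleGraph_le {V : Type*} {G : SimpleGraph V}
    (C : G.ConnectedComponent) {k : ℕ}
    (h : ∀ u v, G.Reachable u v → ∃ w : G.Walk u v, w.length ≤ k) : C.toSimpleGraph.diam ≤ k := by
  classical
  have hle : C.toSimpleGraph.ediam ≤ k := SimpleGraph.ediam_le_of_edist_le fun ⟨u, hu⟩ ⟨v, hv⟩ => by
    obtain ⟨w, hw⟩ := h u v (ConnectedComponent.exact (hu.trans hv.symm))
    -- A walk never leaves its component, so it restricts to `C` with the same length.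
    have hsupp : ∀ x ∈ w.support, x ∈ C.supp := fun x hx =>
      (ConnectedComponent.sound ⟨(w.takeUntil x hx).reverse⟩).trans hu
    have hlen : (w.induce C.supp hsupp).length = w.length := by
      rw [← Walk.length_map (Embedding.induce C.supp).toHom, w.map_induce hsupp]
      rfl
    refine (SimpleGraph.Walk.edist_le (w.induce C.supp hsupp)).trans ?_
    rw [hlen]
    exact_mod_cast hw
  exact ENat.toNat_le_of_le_natCast hle

theorem theorem3p8 :
    ∃ f : ℕ → ℝ, Filter.Tendsto f Filter.atTop (nhds 0) ∧
      ∀ (n : ℕ) (Y : SimpleGraph (Fin n))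
        (C : (friendsAndStrangers (SimpleGraph.cycleGraph n) Y).ConnectedComponent),
        (C.toSimpleGraph.diam : ℝ) ≤ 8 * (n : ℝ) ^ 4 * (1 + f n) := by
  refine ⟨fun _ => 0, tendsto_const_nhds, fun n Y C => ?_⟩
  have key : C.toSimpleGraph.diam ≤ 8 * n ^ 4 := by
    -- The lifting argument needs `i ≠ i + 1`, hence at least two positions.
    rcases Nat.lt_or_ge n 2 with hn | hn
    · have : Subsingleton (Fin n) := Fin.subsingleton_iff_le_one.mpr (by omega)
      refine C.diam_toSimpleGraph_le fun u v _ => ?_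
      obtain rfl := Subsingleton.elim u v
      exact ⟨.nil, by simp⟩
    · obtain ⟨n, rfl⟩ := Nat.exists_eq_add_of_le' hn
      exact C.diam_toSimpleGraph_le fun _ _ h =>
        FriendsAndStrangers.exists_walk_length_le_of_reachable h
  simp only [add_zero, mul_one]
  exact_mod_cast key
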